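/- Let $n\ge 4$. A unicyclic graph is a finite simple connected graph with as many edges as vertices (equivalently, a connected graph containing exactly one cycle); its girth is the length of its cycle. For a graph $G$ of order $n$ with adjacency matrix $A(G)$ and diagonal degree matrix $D(G)$, let $\nu_1(G)\ge\dots\ge\nu_n(G)\ge 0$ be the eigenvalues, counted with multiplicity, of the signless Laplacian matrix $Q(G)=D(G)+A(G)$. The incidence energy of $G$ is $IE(G)=\sum_{i=1}^n\sqrt{\nu_i(G)}$. Let $S_4'$ be the graph of order $n$ obtained from a cycle of length $4$ by attaching $n-4$ pendent vertices to one and the same vertex of the cycle. Then $S_4'$ is, up to isomorphism, the unique graph with minimal incidence energy among all unicyclic graphs of order $n$ with even girth: $S_4'$ is such a graph, and every unicyclic graph $G$ of order $n$ with even girth satisfies $IE(G)\ge IE(S_4')$, with equality if and only if $G\cong S_4'$. -/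

import Mathlib

namespace SimpleGraph

/-- A unicyclic graph: a finite connected graph with as many edges as vertices. -/
def IsUnicyclic {V : Type*} [Fintype V] (G : SimpleGraph V) : Prop :=
  G.Connected ∧ G.edgeSet.ncard = Fintype.card V

/-- The signless Laplacian matrix `Q(G) = D(G) + A(G)` with real entries. -/
def signlessLapMatrix {V : Type*} [Fintype V] [DecidableEq V] (G : SimpleGraph V)
    [DecidableRel G.Adj] : Matrix V V ℝ :=
  G.degMatrix ℝ + G.adjMatrix ℝ

theorem isHermitian_signlessLapMatrix {V : Type*} [Fintype V] [DecidableEq V]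
    (G : SimpleGraph V) [DecidableRel G.Adj] : G.signlessLapMatrix.IsHermitian := by
  ext i j
  by_cases h : i = j
  · subst h; simp
  · simp [signlessLapMatrix, degMatrix, h, Ne.symm h, adj_comm]

open Classical in
/-- The incidence energy `IE(G)`: the sum of the square roots of the eigenvalues of `Q(G)`,
counted with multiplicity. -/
noncomputable def incidenceEnergy {V : Type*} [Fintype V] (G : SimpleGraph V) : ℝ :=
  ∑ i, √(G.isHermitian_signlessLapMatrix.eigenvalues i)

/-- The graph `S₄'` of order `n ≥ 4`: a cycle of length four (the left summand) with `n - 4`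
pendent vertices (the right summand), all attached to the same vertex of the cycle. -/
def starC4 (n : ℕ) : SimpleGraph (Fin 4 ⊕ Fin (n - 4)) where
  Adj x y :=
    match x, y with
    | Sum.inl i, Sum.inl j => (cycleGraph 4).Adj i j
    | Sum.inl i, Sum.inr _ => i = 3
    | Sum.inr _, Sum.inl i => i = 3
    | Sum.inr _, Sum.inr _ => False
  symm := ⟨by
    rintro (i | i) (j | j) h
    · exact (cycleGraph 4).adj_symm h
    all_goals exact h⟩
  loopless := ⟨by
    rintro (i | i) h
    · exact (cycleGraph 4).loopless.irrefl i h
    · exact h⟩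

end SimpleGraph

/-! ### Square roots as logarithmic integrals -/

section LogIntegral

open MeasureTheory Set

/-! Substituting s = √a t gives ∫ log(1 + a/s²) ds = C√a over (0, ∞), with C > 0 independent of a.
Summing over the spectrum, C·IE(G) is the integral of log det(1 + s⁻²Q), so energies can be compared
by comparing det(1 + xQ) for every x > 0 (`sum_sqrt_le_of_prod_le`, `sum_sqrt_lt_of_prod_lt`).

A unicyclic graph of even girth is bipartite, so Q is conjugate to the Laplacian L by a diagonal
sign matrix and det(1 + xQ) = det(1 + xL).

This determinant P and its principal minors M(u) are bounded below together, by induction on the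
order, over connected triangle-free graphs with as many edges as vertices
(`lapBounds_of_triangle_free`). Parity of the girth is dropped because the induction shortens cycles
one vertex at a time. For S₄', with M taken at the centre, adding a pendent vertex there replaces
(P, M) by ((1+x)P + xM, (1+x)M). Adding a leaf at w to any graph replaces P by (1+x)P + xM(w) and
multiplies each minor of an old vertex by at least 1+x (`lapBounds_of_leaf`). A graph without leaves
is a cycle; if it is longer than 4, suppressing a vertex shows that it strictly exceeds the same
recursion (`suppress_bounds`), and the 4-cycle is the base case.

Equality for P at a single x already forces a vertex of degree n - 2, and such a graph is S₄'
(`nonempty_iso_starC4`). -/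

theorem integrableOn_log_one_add_inv_sq :
    IntegrableOn (fun s : ℝ => Real.log (1 + (s ^ 2)⁻¹)) (Ioi 0) := by
  rw [← Ioc_union_Ioi_eq_Ioi zero_le_one]
  refine IntegrableOn.union ?_ ?_
  -- Near 0 the only singularity is that of -2 log s, which is integrable; beyond 1 the integrand is
  -- at most s⁻².
  · have h1 : IntegrableOn (fun s : ℝ => Real.log (1 + s ^ 2) - 2 * Real.log s) (Ioc 0 1) := by
      rw [← intervalIntegrable_iff_integrableOn_Ioc_of_le zero_le_one]
      refine IntervalIntegrable.sub ?_ (intervalIntegral.intervalIntegrable_log'.const_mul 2)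
      refine Continuous.intervalIntegrable ?_ 0 1
      exact Continuous.log (by fun_prop) fun s => by positivity
    refine h1.congr_fun (fun s hs => ?_) measurableSet_Ioc
    have hs0 : s ≠ 0 := hs.1.ne'
    have : 1 + (s ^ 2)⁻¹ = (1 + s ^ 2) / s ^ 2 := by field_simp; ring
    simp only [this]
    rw [Real.log_div (by positivity) (by positivity), Real.log_pow]
    norm_num
  · have h1 : IntegrableOn (fun s : ℝ => s ^ (-2 : ℝ)) (Ioi 1) :=
      integrableOn_Ioi_rpow_of_lt (by norm_num) one_pos
    refine Integrable.mono' h1 ?_ ?_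
    · exact (by fun_prop : Measurable fun s : ℝ => Real.log (1 + (s ^ 2)⁻¹)).aestronglyMeasurable
    · refine (ae_restrict_iff' measurableSet_Ioi).2 (.of_forall fun s hs => ?_)
      have hs0 : (0 : ℝ) < s := one_pos.trans hs
      have h2 : (0 : ℝ) < (s ^ 2)⁻¹ := by positivity
      rw [Real.norm_of_nonneg (Real.log_nonneg (by linarith)), Real.rpow_neg hs0.le,
        Real.rpow_two]
      linarith [Real.log_le_sub_one_of_pos (by linarith : 0 < 1 + (s ^ 2)⁻¹)]

theorem integral_log_one_add_inv_sq_pos :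
    0 < ∫ s in Ioi (0 : ℝ), Real.log (1 + (s ^ 2)⁻¹) := by
  have hpos : ∀ s ∈ Ioi (0 : ℝ), 0 < Real.log (1 + (s ^ 2)⁻¹) := fun s hs => by
    have : (0 : ℝ) < (s ^ 2)⁻¹ := by have := mem_Ioi.1 hs; positivity
    exact Real.log_pos (by linarith)
  rw [setIntegral_pos_iff_support_of_nonneg_ae
    ((ae_restrict_iff' measurableSet_Ioi).2 (.of_forall fun s hs => (hpos s hs).le))
    integrableOn_log_one_add_inv_sq]
  have : Function.support (fun s : ℝ => Real.log (1 + (s ^ 2)⁻¹)) ∩ Ioi 0 = Ioi 0 :=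
    inter_eq_right.2 fun s hs => (hpos s hs).ne'
  rw [this]
  simp

theorem log_one_add_mul_inv_sq_eq {a : ℝ} (ha : 0 < a) (s : ℝ) :
    Real.log (1 + a * (s ^ 2)⁻¹) = Real.log (1 + (((√a)⁻¹ * s) ^ 2)⁻¹) := by
  rw [mul_pow, inv_pow, Real.sq_sqrt ha.le, mul_inv, inv_inv]

theorem integrableOn_log_one_add_mul_inv_sq {a : ℝ} (ha : 0 ≤ a) :
    IntegrableOn (fun s : ℝ => Real.log (1 + a * (s ^ 2)⁻¹)) (Ioi 0) := by
  rcases ha.eq_or_lt with rfl | ha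
  · simp
  · simp only [log_one_add_mul_inv_sq_eq ha]
    have hb : 0 < (√a)⁻¹ := inv_pos.2 (Real.sqrt_pos.2 ha)
    rw [integrableOn_Ioi_comp_mul_left_iff
      (fun s : ℝ => Real.log (1 + (s ^ 2)⁻¹)) 0 hb, mul_zero]
    exact integrableOn_log_one_add_inv_sq

theorem integral_log_one_add_mul_inv_sq {a : ℝ} (ha : 0 ≤ a) :
    ∫ s in Ioi (0 : ℝ), Real.log (1 + a * (s ^ 2)⁻¹) =
      √a * ∫ s in Ioi (0 : ℝ), Real.log (1 + (s ^ 2)⁻¹) := by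
  rcases ha.eq_or_lt with rfl | ha
  · simp
  · simp only [log_one_add_mul_inv_sq_eq ha]
    have hb : 0 < (√a)⁻¹ := inv_pos.2 (Real.sqrt_pos.2 ha)
    rw [integral_comp_mul_left_Ioi (fun s : ℝ => Real.log (1 + (s ^ 2)⁻¹)) 0 hb]
    simp

section
variable {ι κ : Type*} [Fintype ι] [Fintype κ]

theorem integrableOn_log_prod {μ : ι → ℝ} (hμ : ∀ i, 0 ≤ μ i) :
    IntegrableOn (fun s : ℝ => Real.log (∏ i, (1 + (s ^ 2)⁻¹ * μ i))) (Ioi 0) ∧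
    ∫ s in Ioi (0 : ℝ), Real.log (∏ i, (1 + (s ^ 2)⁻¹ * μ i)) =
      (∑ i, √(μ i)) * ∫ s in Ioi (0 : ℝ), Real.log (1 + (s ^ 2)⁻¹) := by
  have h : ∀ s : ℝ, Real.log (∏ i, (1 + (s ^ 2)⁻¹ * μ i)) =
      ∑ i, Real.log (1 + μ i * (s ^ 2)⁻¹) := fun s => by
    rw [Real.log_prod fun i _ => by have := hμ i; positivity]
    simp only [mul_comm]
  simp only [h]
  refine ⟨integrable_finsetSum _ fun i _ => integrableOn_log_one_add_mul_inv_sq (hμ i), ?_⟩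
  rw [integral_finsetSum _ fun i _ => integrableOn_log_one_add_mul_inv_sq (hμ i), Finset.sum_mul]
  exact Finset.sum_congr rfl fun i _ => integral_log_one_add_mul_inv_sq (hμ i)

/-- The hypothesis is used at x = s⁻². Only positivity of the constant integral matters, never its
value. -/
theorem sum_sqrt_le_of_prod_le {μ : ι → ℝ} {ν : κ → ℝ} (hμ : ∀ i, 0 ≤ μ i) (hν : ∀ i, 0 ≤ ν i)
    (h : ∀ x : ℝ, 0 < x → ∏ i, (1 + x * μ i) ≤ ∏ i, (1 + x * ν i)) :
    ∑ i, √(μ i) ≤ ∑ i, √(ν i) := by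
  obtain ⟨h1, h2⟩ := integrableOn_log_prod hμ
  obtain ⟨h3, h4⟩ := integrableOn_log_prod hν
  refine le_of_mul_le_mul_right ?_ integral_log_one_add_inv_sq_pos
  rw [← h2, ← h4]
  refine setIntegral_mono_on h1 h3 measurableSet_Ioi fun s hs => ?_
  have hs' : (0 : ℝ) < (s ^ 2)⁻¹ := by have := mem_Ioi.1 hs; positivity
  refine Real.log_le_log (Finset.prod_pos fun i _ => ?_) (h _ hs')
  have := hμ i
  positivity

theorem sum_sqrt_lt_of_prod_lt {μ : ι → ℝ} {ν : κ → ℝ} (hμ : ∀ i, 0 ≤ μ i) (hν : ∀ i, 0 ≤ ν i)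
    (h : ∀ x : ℝ, 0 < x → ∏ i, (1 + x * μ i) < ∏ i, (1 + x * ν i)) :
    ∑ i, √(μ i) < ∑ i, √(ν i) := by
  obtain ⟨h1, h2⟩ := integrableOn_log_prod hμ
  obtain ⟨h3, h4⟩ := integrableOn_log_prod hν
  refine lt_of_mul_lt_mul_right ?_ integral_log_one_add_inv_sq_pos.le
  rw [← h2, ← h4, ← sub_pos, ← integral_sub h3 h1]
  have hpos : ∀ s ∈ Ioi (0 : ℝ), 0 < Real.log (∏ i, (1 + (s ^ 2)⁻¹ * ν i)) -
      Real.log (∏ i, (1 + (s ^ 2)⁻¹ * μ i)) := fun s hs => by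
    have hs' : (0 : ℝ) < (s ^ 2)⁻¹ := by have := mem_Ioi.1 hs; positivity
    refine sub_pos.2 (Real.log_lt_log (Finset.prod_pos fun i _ => ?_) (h _ hs'))
    have := hμ i
    positivity
  have hsupp : Function.support (fun s : ℝ => Real.log (∏ i, (1 + (s ^ 2)⁻¹ * ν i)) -
      Real.log (∏ i, (1 + (s ^ 2)⁻¹ * μ i))) ∩ Ioi 0 = Ioi 0 :=
    inter_eq_right.2 fun s hs => (hpos s hs).ne'
  rw [setIntegral_pos_iff_support_of_nonneg_ae
    ((ae_restrict_iff' measurableSet_Ioi).2 (.of_forall fun s hs => (hpos s hs).le))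
    (h3.sub h1), hsupp]
  simp

end

end LogIntegral

/-! ### Schur complements and rank-two perturbations -/

namespace Matrix

variable {W : Type*} [Fintype W] [DecidableEq W]

theorem det_eq_mul_det_schur (M : Matrix W W ℝ) (v : W) (hv : M v v ≠ 0) :
    M.det = M v v *
      det (of fun i j : {y // y ≠ v} => M i j - M i v * M v j / M v v) := by
  let A : Matrix {y // y = v} {y // y = v} ℝ := diagonal fun _ => M v v
  let B : Matrix {y // y = v} {y // y ≠ v} ℝ := of fun _ j => M v j
  let C : Matrix {y // y ≠ v} {y // y = v} ℝ := of fun i _ => M i v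
  let D : Matrix {y // y ≠ v} {y // y ≠ v} ℝ := of fun i j => M i j
  have h1 : M.submatrix (Equiv.sumCompl (· = v)) (Equiv.sumCompl (· = v)) =
      fromBlocks A B C D := by
    ext (⟨i, rfl⟩ | ⟨i, hi⟩) (⟨j, hj⟩ | ⟨j, hj⟩)
    · subst hj; simp [A]
    all_goals simp [B, C, D, hj]
  let _ : Invertible A :=
    { invOf := diagonal fun _ => (M v v)⁻¹
      invOf_mul_self := by simp [A, hv]
      mul_invOf_self := by simp [A, hv] }
  have h2 : ⅟A = diagonal fun _ => (M v v)⁻¹ := rfl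
  rw [← det_submatrix_equiv_self (Equiv.sumCompl (· = v)), h1, det_fromBlocks₁₁, h2]
  congr 1
  · simp [A]
  · congr 1
    ext i j
    simp [B, C, D, mul_apply]
    field_simp

/-- The symmetric matrix supported on the rows and columns `a` and `b`. -/
def pairMatrix (a b : W) (p q r : ℝ) : Matrix W W ℝ :=
  of fun i j => (if i = a ∧ j = a then p else 0) + (if i = b ∧ j = b then q else 0) +
    (if i = a ∧ j = b then r else 0) + (if i = b ∧ j = a then r else 0)

/-- The perturbation factors through a 2-dimensional space, so det(1 + XY) = det(1 + YX) reduces it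
to a 2 × 2 determinant. The case a = b is allowed; the last factor then vanishes. -/
theorem det_add_pairMatrix {K : Matrix W W ℝ} (hK : K.IsSymm) (hdet : K.det ≠ 0) (a b : W)
    (p q r : ℝ) :
    (K + pairMatrix a b p q r).det = K.det * (1 + p * K⁻¹ a a + q * K⁻¹ b b + 2 * r * K⁻¹ a b +
      (p * q - r ^ 2) * (K⁻¹ a a * K⁻¹ b b - K⁻¹ a b ^ 2)) := by
  have hsymm : K⁻¹ b a = K⁻¹ a b := hK.inv.apply a b
  let U : Matrix W (Fin 2) ℝ := of fun i => ![if i = a then 1 else 0, if i = b then 1 else 0]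
  let R : Matrix (Fin 2) W ℝ := of ![fun j => (if j = a then p else 0) + (if j = b then r else 0),
    fun j => (if j = a then r else 0) + (if j = b then q else 0)]
  have hU : pairMatrix a b p q r = U * R := by
    ext i j
    simp only [pairMatrix, U, R, mul_apply, Fin.sum_univ_two, of_apply, cons_val_zero,
      cons_val_one, ite_and]
    split_ifs <;> ring
  have hunit : IsUnit K.det := hdet.isUnit
  have h2 : K + pairMatrix a b p q r = K * (1 + (K⁻¹ * U) * R) := by
    rw [hU, Matrix.mul_add, Matrix.mul_one, Matrix.mul_assoc K⁻¹, mul_nonsing_inv_cancel_left _ _ hunit]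
  have h3 : ∀ i, (K⁻¹ * U) i 0 = K⁻¹ i a ∧ (K⁻¹ * U) i 1 = K⁻¹ i b := fun i => by
    simp [U, mul_apply]
  have h4 : ∀ (Y : Matrix W (Fin 2) ℝ) k, (R * Y) 0 k = p * Y a k + r * Y b k ∧
      (R * Y) 1 k = r * Y a k + q * Y b k := fun Y k => by
    simp only [mul_apply]
    simp [R, add_mul, Finset.sum_add_distrib]
  rw [h2, det_mul, det_one_add_mul_comm, det_fin_two]
  simp only [add_apply, (h4 _ _).1, (h4 _ _).2, (h3 _).1, (h3 _).2, hsymm, one_apply]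
  simp
  left
  ring

theorem PosDef.inv_minor_pos {K : Matrix W W ℝ} (hK : K.PosDef) {a b : W} (hab : a ≠ b) :
    0 < K⁻¹ a a * K⁻¹ b b - K⁻¹ a b ^ 2 := by
  have h := (hK.inv.submatrix (e := ![a, b]) (by
    intro i j; fin_cases i <;> fin_cases j <;> simp [hab, hab.symm])).det_pos
  have hs : K⁻¹ b a = K⁻¹ a b := hK.inv.isHermitian.apply a b
  rw [det_fin_two] at h
  simp [hs] at h
  linarith

end Matrix

/-! ### The matrix 1 + xL and maximum principles for its inverse -/

namespace SimpleGraph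

open Matrix

variable {V : Type*} [Fintype V] [DecidableEq V]

/-- The positive definite matrix `1 + x L(G)`. -/
noncomputable def shiftedLap (G : SimpleGraph V) [DecidableRel G.Adj] (x : ℝ) : Matrix V V ℝ :=
  1 + x • G.lapMatrix ℝ

variable (G : SimpleGraph V) [DecidableRel G.Adj] {x : ℝ}

theorem shiftedLap_apply (x : ℝ) (i j : V) : G.shiftedLap x i j =
    if i = j then 1 + x * G.degree i else if G.Adj i j then -x else 0 := by
  by_cases h : i = j
  · subst h; simp [shiftedLap, lapMatrix, degMatrix]
  · simp [shiftedLap, lapMatrix, degMatrix, h]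
    split_ifs <;> simp

theorem posDef_shiftedLap (hx : 0 < x) : (G.shiftedLap x).PosDef :=
  PosDef.one.add_posSemidef ((posSemidef_lapMatrix ℝ G).smul hx.le)

theorem shiftedLap_mulVec (z : V → ℝ) (i : V) :
    (G.shiftedLap x *ᵥ z) i = z i + x * ∑ j ∈ G.neighborFinset i, (z i - z j) := by
  rw [shiftedLap, add_mulVec, one_mulVec, smul_mulVec, Pi.add_apply, Pi.smul_apply,
    lapMatrix_mulVec_apply]
  simp [Finset.sum_sub_distrib]

theorem shiftedLap_mulVec_inv (hx : 0 < x) (i a : V) :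
    (G.shiftedLap x *ᵥ fun k => (G.shiftedLap x)⁻¹ k a) i = if i = a then 1 else 0 := by
  have h := mul_nonsing_inv (G.shiftedLap x) (G.posDef_shiftedLap hx).det_pos.ne'.isUnit
  have := congrFun (congrFun h i) a
  rwa [one_apply] at this

/-- Minimum principle: where a column of the inverse is smallest, its Laplacian term is nonpositive
while the right-hand side is 0 or 1. -/
theorem shiftedLap_inv_nonneg (hx : 0 < x) (i a : V) : 0 ≤ (G.shiftedLap x)⁻¹ i a := by
  obtain ⟨k, -, hk⟩ := Finset.exists_min_image Finset.univ (fun k => (G.shiftedLap x)⁻¹ k a)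
    ⟨i, Finset.mem_univ i⟩
  refine le_trans ?_ (hk i (Finset.mem_univ i))
  have h := G.shiftedLap_mulVec_inv hx k a
  rw [shiftedLap_mulVec] at h
  have h1 : ∑ j ∈ G.neighborFinset k, ((G.shiftedLap x)⁻¹ k a - (G.shiftedLap x)⁻¹ j a) ≤ 0 :=
    Finset.sum_nonpos fun j _ => sub_nonpos.2 (hk j (Finset.mem_univ j))
  have h2 : (0 : ℝ) ≤ if k = a then 1 else 0 := by split_ifs <;> norm_num
  nlinarith

/-- Maximum principle: column a is largest at a, and its equation there gives a value at most 1. The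
value 1 would spread to a neighbour j, where 1 plus a nonnegative term would have to be 0. -/
theorem shiftedLap_inv_lt_one (hx : 0 < x) {a : V} (ha : 0 < G.degree a) :
    (G.shiftedLap x)⁻¹ a a < 1 := by
  set z : V → ℝ := fun k => (G.shiftedLap x)⁻¹ k a with hz
  obtain ⟨k, -, hk⟩ := Finset.exists_max_image Finset.univ z ⟨a, Finset.mem_univ a⟩
  have hmul := G.shiftedLap_mulVec_inv hx
  have hle : ∀ i, z i ≤ z a := by
    have h := hmul k a
    rw [shiftedLap_mulVec] at h
    have h1 : 0 ≤ ∑ j ∈ G.neighborFinset k, (z k - z j) :=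
      Finset.sum_nonneg fun j _ => sub_nonneg.2 (hk j (Finset.mem_univ j))
    by_cases hka : k = a
    · subst hka; exact fun i => hk i (Finset.mem_univ i)
    · rw [if_neg hka] at h
      have : z k ≤ 0 := by
        have : 0 ≤ x * ∑ j ∈ G.neighborFinset k, (z k - z j) := by positivity
        linarith
      intro i
      exact (hk i (Finset.mem_univ i)).trans (this.trans (G.shiftedLap_inv_nonneg hx a a))
  have h := hmul a a
  rw [shiftedLap_mulVec, if_pos rfl] at h
  have h1 : ∀ j ∈ G.neighborFinset a, 0 ≤ z a - z j := fun j _ => sub_nonneg.2 (hle j)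
  refine lt_of_le_of_ne ?_ fun heq => ?_
  · have := mul_nonneg hx.le (Finset.sum_nonneg h1)
    change z a ≤ 1
    change z a + _ = 1 at h
    linarith
  · change z a = 1 at heq
    change z a + _ = 1 at h
    have h0 : ∑ j ∈ G.neighborFinset a, (z a - z j) = 0 := by
      have : x * ∑ j ∈ G.neighborFinset a, (z a - z j) = 0 := by linarith
      exact (mul_eq_zero.1 this).resolve_left hx.ne'
    obtain ⟨j, hj⟩ := (G.degree_pos_iff_exists_adj a).1 ha
    have hzj : z j = 1 := by
      have := (Finset.sum_eq_zero_iff_of_nonneg h1).1 h0 j ((G.mem_neighborFinset a j).2 hj)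
      linarith
    have h2 := hmul j a
    rw [shiftedLap_mulVec, if_neg hj.ne'] at h2
    change z j + _ = 0 at h2
    have h3 : 0 ≤ ∑ i ∈ G.neighborFinset j, (z j - z i) :=
      Finset.sum_nonneg fun i _ => by rw [hzj, ← heq]; exact sub_nonneg.2 (hle i)
    have := mul_nonneg hx.le h3
    change z j + x * ∑ i ∈ G.neighborFinset j, (z j - z i) = 0 at h2
    linarith

/-- The determinant of `1 + x L(G)`. -/
noncomputable def lapDet (x : ℝ) : ℝ := (G.shiftedLap x).det

/-- The principal minor of `1 + x L(G)` obtained by deleting the row and column of `u`. -/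
noncomputable def lapMinor (x : ℝ) (u : V) : ℝ :=
  (G.shiftedLap x).det * (G.shiftedLap x)⁻¹ u u

end SimpleGraph

namespace SimpleGraph

open Matrix

variable {V : Type*} [Fintype V] [DecidableEq V] (G : SimpleGraph V) [DecidableRel G.Adj] {x : ℝ}

/-- The graph obtained by deleting the vertex `v`. -/
abbrev deleteVert (v : V) : SimpleGraph {y // y ≠ v} := G.comap Subtype.val

theorem degree_eq_deleteVert_degree_add (v : V) (y : {y // y ≠ v}) :
    G.degree y = (G.deleteVert v).degree y + if G.Adj y v then 1 else 0 := by
  have h1 := degree_eq_sum_if_adj G (R := ℕ) (y : V)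
  have h2 := degree_eq_sum_if_adj (G.deleteVert v) (R := ℕ) y
  rw [Fintype.sum_eq_add_sum_subtype_ne _ v] at h1
  simp only [Nat.cast_id] at h1 h2
  rw [h1, h2, add_comm]
  rfl

/-- The determinant is affine in a diagonal entry, with slope the corresponding minor. Identities
with a free parameter r thus yield `lapDet` at r = 0 and `lapMinor` from the increment to r = 1. -/
theorem det_shiftedLap_add (hx : 0 < x) (u : V) (r : ℝ) :
    (G.shiftedLap x + pairMatrix u u r 0 0).det = G.lapDet x + r * G.lapMinor x u := by
  have hK := G.posDef_shiftedLap hx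
  rw [det_add_pairMatrix (by exact hK.isHermitian) hK.det_pos.ne', lapDet, lapMinor]
  ring

theorem lapDet_pos (hx : 0 < x) : 0 < G.lapDet x := (G.posDef_shiftedLap hx).det_pos

theorem lapMinor_lt_lapDet (hx : 0 < x) {u : V} (hu : 0 < G.degree u) :
    G.lapMinor x u < G.lapDet x :=
  mul_lt_of_lt_one_right (G.lapDet_pos hx) (G.shiftedLap_inv_lt_one hx hu)

/-! ### Deleting a leaf -/

section Leaf

variable {G} {v : V} {w : {y // y ≠ v}} (hw : ∀ y, G.Adj v y ↔ y = w)
include hw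

omit [DecidableEq V] in
theorem degree_eq_one_of_adj_iff : G.degree v = 1 := by
  rw [← card_neighborFinset_eq_degree, Finset.card_eq_one]
  exact ⟨w, by ext y; simp [hw]⟩

/-- Eliminating v changes only the diagonal entry at w: the lost degree contributes x and the Schur
complement -x²/(1+x), in total x/(1+x). -/
theorem det_shiftedLap_leaf_add (hx : 0 < x) (u : {y // y ≠ v}) (r : ℝ) :
    (G.shiftedLap x + pairMatrix (u : V) u r 0 0).det =
      (1 + x) * ((G.deleteVert v).shiftedLap x + pairMatrix w u (x / (1 + x)) r 0).det := by
  have hvv : (G.shiftedLap x + pairMatrix (u : V) u r 0 0) v v = 1 + x := by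
    simp [shiftedLap_apply, pairMatrix, degree_eq_one_of_adj_iff hw, u.2.symm]
  have hx' : 1 + x ≠ 0 := by positivity
  rw [det_eq_mul_det_schur _ v (by rw [hvv]; exact hx'), hvv]
  congr 2
  ext i j
  have hv : ∀ y : {y // y ≠ v}, G.Adj y v ↔ y = w := fun y => by
    rw [adj_comm, hw, Subtype.ext_iff]
  have hv' : ∀ y : {y // y ≠ v}, G.Adj v y ↔ y = w := fun y => by rw [hw, Subtype.ext_iff]
  simp only [of_apply, Matrix.add_apply, shiftedLap_apply, pairMatrix, i.2, u.2.symm,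
    j.2.symm, if_false, false_and, and_false, hv, hv', degree_eq_deleteVert_degree_add,
    degree_eq_one_of_adj_iff hw, Subtype.ext_iff.symm, comap_adj]
  by_cases hij : i = j
  · subst hij
    by_cases hi : i = w
    · subst hi; simp; field_simp; split_ifs <;> ring
    · simp [hi]
  · by_cases hi : i = w
    · subst hi; simp [hij, Ne.symm hij]
    · simp [hi, hij]

theorem det_shiftedLap_leaf_add_self (hx : 0 < x) {r : ℝ} (hr : 0 ≤ r) :
    (G.shiftedLap x + pairMatrix v v r 0 0).det =
      (1 + x + r) * ((G.deleteVert v).shiftedLap x +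
        pairMatrix w w (x - x ^ 2 / (1 + x + r)) 0 0).det := by
  have hvv : (G.shiftedLap x + pairMatrix v v r 0 0) v v = 1 + x + r := by
    simp [shiftedLap_apply, pairMatrix, degree_eq_one_of_adj_iff hw]
  have hx' : 1 + x + r ≠ 0 := by positivity
  rw [det_eq_mul_det_schur _ v (by rw [hvv]; exact hx'), hvv]
  congr 2
  ext i j
  have hv : ∀ y : {y // y ≠ v}, G.Adj y v ↔ y = w := fun y => by
    rw [adj_comm, hw, Subtype.ext_iff]
  have hv' : ∀ y : {y // y ≠ v}, G.Adj v y ↔ y = w := fun y => by rw [hw, Subtype.ext_iff]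
  simp only [of_apply, Matrix.add_apply, shiftedLap_apply, pairMatrix, i.2, j.2,
    j.2.symm, if_false, false_and, and_false, hv, hv', degree_eq_deleteVert_degree_add,
    Subtype.ext_iff.symm, comap_adj]
  by_cases hij : i = j
  · subst hij
    by_cases hi : i = w
    · subst hi; simp; ring
    · simp [hi]
  · by_cases hi : i = w
    · subst hi; simp [hij, Ne.symm hij]
    · simp [hi, hij]

theorem lapDet_leaf (hx : 0 < x) :
    G.lapDet x = (1 + x) * (G.deleteVert v).lapDet x + x * (G.deleteVert v).lapMinor x w := by
  have h := det_shiftedLap_leaf_add_self hw hx le_rfl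
  rw [det_shiftedLap_add _ hx, det_shiftedLap_add _ hx] at h
  have hx' : 1 + x ≠ 0 := by positivity
  field_simp at h
  linear_combination h

theorem lapMinor_leaf_self (hx : 0 < x) :
    G.lapMinor x v = (G.deleteVert v).lapDet x + x * (G.deleteVert v).lapMinor x w := by
  have h := det_shiftedLap_leaf_add_self hw hx zero_le_one
  rw [det_shiftedLap_add _ hx, det_shiftedLap_add _ hx, lapDet_leaf hw hx] at h
  have hx' : 1 + x + 1 ≠ 0 := by positivity
  field_simp at h
  linear_combination h

theorem lapMinor_leaf_eq (hx : 0 < x) (u : {y // y ≠ v}) :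
    G.lapMinor x u = (1 + x) * (G.deleteVert v).lapMinor x u +
      x * ((G.deleteVert v).lapDet x * (((G.deleteVert v).shiftedLap x)⁻¹ w w *
        ((G.deleteVert v).shiftedLap x)⁻¹ u u - ((G.deleteVert v).shiftedLap x)⁻¹ w u ^ 2)) := by
  have h := det_shiftedLap_leaf_add hw hx u 1
  have hK := (G.deleteVert v).posDef_shiftedLap hx
  rw [det_shiftedLap_add _ hx, det_add_pairMatrix (by exact hK.isHermitian) hK.det_pos.ne',
    lapDet_leaf hw hx, ← lapDet] at h
  have hx' : 1 + x ≠ 0 := by positivity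
  have h1 : (G.deleteVert v).lapMinor x w =
    (G.deleteVert v).lapDet x * ((G.deleteVert v).shiftedLap x)⁻¹ w w := rfl
  have h2 : (G.deleteVert v).lapMinor x u =
    (G.deleteVert v).lapDet x * ((G.deleteVert v).shiftedLap x)⁻¹ u u := rfl
  rw [h1] at h
  rw [h2]
  field_simp at h
  linear_combination h

theorem lapMinor_leaf_neighbor (hx : 0 < x) :
    G.lapMinor x w = (1 + x) * (G.deleteVert v).lapMinor x w := by
  rw [lapMinor_leaf_eq hw hx]; ring

/-- The excess is a positive multiple of the 2 × 2 minor of the inverse at w and u, positive exactly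
because u and w differ. -/
theorem lapMinor_leaf_lt (hx : 0 < x) {u : {y // y ≠ v}} (hu : u ≠ w) :
    (1 + x) * (G.deleteVert v).lapMinor x u < G.lapMinor x u := by
  rw [lapMinor_leaf_eq hw hx]
  have := ((G.deleteVert v).posDef_shiftedLap hx).inv_minor_pos hu.symm
  have := mul_pos hx (mul_pos ((G.deleteVert v).lapDet_pos hx) this)
  linarith

end Leaf

/-! ### Suppressing a vertex of degree two -/

section Suppress

/-- The graph obtained by deleting `v` and joining `a` to `b`. -/
abbrev suppress (v : V) (a b : {y // y ≠ v}) : SimpleGraph {y // y ≠ v} :=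
  G.deleteVert v ⊔ edge a b

variable {G} {v : V} {a b : {y // y ≠ v}} (hab : a ≠ b) (hv : ∀ y, G.Adj v y ↔ y = a ∨ y = b)
  (hnadj : ¬ G.Adj a b)
include hab hv

theorem degree_eq_two_of_adj_iff : G.degree v = 2 := by
  rw [← card_neighborFinset_eq_degree, Finset.card_eq_two]
  exact ⟨a, b, fun h => hab (Subtype.ext h), by ext y; simp [hv]⟩

theorem det_shiftedLap_suppressed_add (hx : 0 < x) (r : ℝ) :
    (G.shiftedLap x + pairMatrix (a : V) a r 0 0).det =
      (1 + 2 * x) * ((G.deleteVert v).shiftedLap x + pairMatrix a b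
        (x - x ^ 2 / (1 + 2 * x) + r) (x - x ^ 2 / (1 + 2 * x)) (-(x ^ 2 / (1 + 2 * x)))).det := by
  have hvv : (G.shiftedLap x + pairMatrix (a : V) a r 0 0) v v = 1 + 2 * x := by
    simp [shiftedLap_apply, pairMatrix, degree_eq_two_of_adj_iff hab hv, a.2.symm]; ring
  have hx' : 1 + 2 * x ≠ 0 := by positivity
  rw [det_eq_mul_det_schur _ v (by rw [hvv]; exact hx'), hvv]
  congr 2
  ext i j
  have hv1 : ∀ y : {y // y ≠ v}, G.Adj y v ↔ y = a ∨ y = b := fun y => by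
    rw [adj_comm, hv, Subtype.ext_iff, Subtype.ext_iff]
  have hv' : ∀ y : {y // y ≠ v}, G.Adj v y ↔ y = a ∨ y = b := fun y => by
    rw [hv, Subtype.ext_iff, Subtype.ext_iff]
  simp only [of_apply, Matrix.add_apply, shiftedLap_apply, pairMatrix, i.2, a.2.symm,
    j.2.symm, if_false, false_and, and_false, hv1, hv', degree_eq_deleteVert_degree_add,
    Subtype.ext_iff.symm, comap_adj]
  by_cases hij : i = j
  · subst hij
    by_cases hi : i = a
    · subst hi; simp [hab]; ring
    · by_cases hi' : i = b
      · subst hi'; simp [hi]; ring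
      · simp [hi, hi']
  · by_cases hi : i = a
    · subst hi
      by_cases hj : j = b
      · subst hj; simp [hab, hab.symm]; ring
      · simp [hij, Ne.symm hij, hj, hab]
    · by_cases hi' : i = b
      · subst hi'
        by_cases hj : j = a
        · subst hj; simp [hab, hab.symm]; ring
        · simp [hij, Ne.symm hij, hj, hab.symm]
      · simp [hi, hi', hij]

omit hv in
include hnadj in
theorem suppress_degree (y : {y // y ≠ v}) : (G.suppress v a b).degree y =
    (G.deleteVert v).degree y + if y = a ∨ y = b then 1 else 0 := by
  have h1 := degree_eq_sum_if_adj (G.suppress v a b) (R := ℕ) y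
  have h2 := degree_eq_sum_if_adj (G.deleteVert v) (R := ℕ) y
  have h3 : (if y = a ∨ y = b then 1 else 0 : ℕ) =
      ∑ j, if (y = a ∧ j = b) ∨ (y = b ∧ j = a) then 1 else 0 := by
    by_cases hya : y = a
    · subst hya; simp [hab]
    · by_cases hyb : y = b
      · subst hyb; simp [hab.symm]
      · simp [hya, hyb]
  simp only [Nat.cast_id] at h1 h2
  rw [h1, h2, h3, ← Finset.sum_add_distrib]
  refine Finset.sum_congr rfl fun j _ => ?_
  have h4 : (G.suppress v a b).Adj y j ↔
      (G.deleteVert v).Adj y j ∨ ((y = a ∧ j = b) ∨ (y = b ∧ j = a)) := by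
    rw [suppress, sup_adj, edge_adj]
    constructor
    · tauto
    · rintro (h | ⟨rfl, rfl⟩ | ⟨rfl, rfl⟩)
      · exact Or.inl h
      · exact Or.inr ⟨Or.inl ⟨rfl, rfl⟩, hab⟩
      · exact Or.inr ⟨Or.inr ⟨rfl, rfl⟩, hab.symm⟩
  have h5 : (y = a ∧ j = b) ∨ (y = b ∧ j = a) → ¬ (G.deleteVert v).Adj y j := by
    rintro (⟨rfl, rfl⟩ | ⟨rfl, rfl⟩)
    · exact hnadj
    · exact fun h => hnadj h.symm
  by_cases h6 : (y = a ∧ j = b) ∨ (y = b ∧ j = a)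
  · rw [if_pos h6, if_neg (h5 h6), if_pos (h4.2 (Or.inr h6)), zero_add]
  · rw [if_neg h6, add_zero]
    exact if_congr (by rw [h4]; tauto) rfl rfl

omit hv in
include hnadj in
theorem shiftedLap_suppress (r : ℝ) : (G.suppress v a b).shiftedLap x + pairMatrix a a r 0 0 =
    (G.deleteVert v).shiftedLap x + pairMatrix a b (x + r) x (-x) := by
  ext i j
  simp only [Matrix.add_apply, shiftedLap_apply, pairMatrix, suppress_degree hab hnadj, of_apply]
  by_cases hij : i = j
  · subst hij
    by_cases hi : i = a
    · subst hi; simp [hab]; ring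
    · by_cases hi' : i = b
      · subst hi'; simp [hi]; ring
      · simp [hi, hi']
  · have h1 : ¬ (i = a ∧ j = a) := fun h => hij (h.1.trans h.2.symm)
    have h2 : ¬ (i = b ∧ j = b) := fun h => hij (h.1.trans h.2.symm)
    simp only [if_neg hij, suppress, sup_adj, edge_adj, h1, h2, if_false, add_zero, zero_add]
    by_cases h3 : i = a ∧ j = b
    · obtain ⟨rfl, rfl⟩ := h3
      simp [hab, hnadj]
    · by_cases h4 : i = b ∧ j = a
      · obtain ⟨rfl, rfl⟩ := h4
        have hn : ¬ G.Adj i j := fun h => hnadj h.symm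
        simp [hab.symm, hn]
      · simp [h3, h4]

include hnadj

/-- Both G and the suppressed graph are perturbations at a, b of the same matrix on the graph
without v, so every quantity is a polynomial in its inverse entries α, β, γ. The two differences are
pxα and px(1 - α + 2γ), positive since 0 < α < 1 and γ ≥ 0. -/
theorem suppress_bounds (hx : 0 < x) (ha : 0 < (G.deleteVert v).degree a) :
    (1 + x) * (G.suppress v a b).lapMinor x a < G.lapMinor x a ∧
    (1 + x) * (G.suppress v a b).lapDet x + x * (G.suppress v a b).lapMinor x a <
      G.lapDet x := by
  have hK := (G.deleteVert v).posDef_shiftedLap hx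
  have h0 := det_shiftedLap_suppressed_add hab hv hx 0
  have h1 := det_shiftedLap_suppressed_add hab hv hx 1
  have k0 := congrArg Matrix.det (shiftedLap_suppress (x := x) hab hnadj 0)
  have k1 := congrArg Matrix.det (shiftedLap_suppress (x := x) hab hnadj 1)
  rw [det_shiftedLap_add _ hx, det_add_pairMatrix (by exact hK.isHermitian) hK.det_pos.ne'] at h0 h1 k0 k1
  have hp := (G.deleteVert v).lapDet_pos hx
  have hα := (G.deleteVert v).shiftedLap_inv_lt_one hx ha
  have hα' := hK.inv.diag_pos (i := a)
  have hγ := (G.deleteVert v).shiftedLap_inv_nonneg hx a b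
  rw [← lapDet] at h0 h1 k0 k1
  set p := (G.deleteVert v).lapDet x
  set α := ((G.deleteVert v).shiftedLap x)⁻¹ a a
  set β := ((G.deleteVert v).shiftedLap x)⁻¹ b b
  set γ := ((G.deleteVert v).shiftedLap x)⁻¹ a b
  have hx' : 1 + 2 * x ≠ 0 := by positivity
  have e0 : G.lapDet x = p * (1 + 2 * x + (x + x ^ 2) * (α + β) - 2 * x ^ 2 * γ +
      x ^ 2 * (α * β - γ ^ 2)) := by
    field_simp at h0
    refine mul_left_cancel₀ hx' ?_
    linear_combination h0
  have e1 : G.lapMinor x a = p * ((1 + 2 * x) * α + (x + x ^ 2) * (α * β - γ ^ 2)) := by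
    rw [e0] at h1
    field_simp at h1
    refine mul_left_cancel₀ hx' ?_
    linear_combination h1
  have f0 : (G.suppress v a b).lapDet x = p * (1 + x * (α + β) - 2 * x * γ) := by
    linear_combination k0
  have f1 : (G.suppress v a b).lapMinor x a = p * (α + x * (α * β - γ ^ 2)) := by
    linear_combination k1 - f0
  rw [e0, e1, f0, f1]
  constructor
  · have : 0 < x * (p * α) := by positivity
    linarith
  · have : 0 < x * (p * (1 - α + 2 * γ)) := by
      have : 0 < 1 - α + 2 * γ := by linarith
      positivity
    linarith

end Suppress

end SimpleGraph

/-! ### Inductive lower bounds with S₄' as extremal case -/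

namespace SimpleGraph

open Matrix

universe u

/-- Used with f collapsing a deleted vertex onto one of its neighbours. -/
theorem Connected.of_map {V W : Type*} {G : SimpleGraph V} {H : SimpleGraph W} (hG : G.Connected)
    {f : V → W} (hf : Function.Surjective f)
    (h : ∀ x y, G.Adj x y → f x = f y ∨ H.Adj (f x) (f y)) : H.Connected := by
  have key : ∀ x y, G.Reachable x y → H.Reachable (f x) (f y) := by
    rintro x y ⟨p⟩
    induction p with
    | nil => exact Reachable.refl _
    | cons hadj _ ih =>
      rcases h _ _ hadj with h1 | h1
      · rwa [h1]
      · exact h1.reachable.trans ih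
  have := hG.nonempty.map f
  refine ⟨fun x y => ?_⟩
  obtain ⟨x, rfl⟩ := hf x
  obtain ⟨y, rfl⟩ := hf y
  exact key x y (hG.preconnected x y)

/-- The principal minor at the centre of `S₄'` with `m` pendent vertices. -/
noncomputable def starC4Minor (x : ℝ) (m : ℕ) : ℝ :=
  (1 + x) ^ m * ((1 + 2 * x) * (1 + 4 * x + 2 * x ^ 2))

/-- The value of `det (1 + x Q)` for `S₄'` with `m` pendent vertices. -/
noncomputable def starC4Det (x : ℝ) (m : ℕ) : ℝ :=
  (1 + x) ^ m * ((1 + 2 * x) ^ 2 * (1 + 4 * x)) + m * (x / (1 + x)) * starC4Minor x m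

theorem starC4Minor_succ (x : ℝ) (m : ℕ) :
    starC4Minor x (m + 1) = (1 + x) * starC4Minor x m := by
  simp only [starC4Minor]; ring

theorem starC4Det_succ {x : ℝ} (hx : 0 < x) (m : ℕ) :
    starC4Det x (m + 1) = (1 + x) * starC4Det x m + x * starC4Minor x m := by
  have : 1 + x ≠ 0 := by positivity
  simp only [starC4Det, starC4Minor_succ]
  push_cast
  field_simp
  ring

theorem cycleGraph_four_adj_iff :
    ∀ i j : Fin 4, (cycleGraph 4).Adj i j ↔ (i.val + j.val) % 2 = 1 := by
  decide

/-- The parameter r records the determinant and the minor at one vertex of the 4-cycle at once. -/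
theorem det_cycle_four (x r : ℝ) :
    (!![1 + 2 * x + r, -x, 0, -x; -x, 1 + 2 * x, -x, 0; 0, -x, 1 + 2 * x, -x;
      -x, 0, -x, 1 + 2 * x] : Matrix (Fin 4) (Fin 4) ℝ).det =
      (1 + 2 * x) ^ 2 * (1 + 4 * x) + r * ((1 + 2 * x) * (1 + 4 * x + 2 * x ^ 2)) := by
  simp [det_succ_row_zero, Fin.sum_univ_succ, Fin.succAbove]
  ring

section

variable {V : Type u} [Fintype V] [DecidableEq V] {G : SimpleGraph V} [DecidableRel G.Adj] {x : ℝ}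

theorem lapDet_and_lapMinor_of_cycle_four (hx : 0 < x) {f : Fin 4 → V} (hf : Function.Bijective f)
    (hadj : ∀ i j, G.Adj (f i) (f j) ↔ (cycleGraph 4).Adj i j) :
    G.lapDet x = starC4Det x 0 ∧ G.lapMinor x (f 0) = starC4Minor x 0 := by
  let e := Equiv.ofBijective f hf
  have hdeg : ∀ i, G.degree (f i) = 2 := fun i => by
    have h := degree_eq_sum_if_adj G (R := ℕ) (f i)
    rw [← e.sum_comp] at h
    simp only [Nat.cast_id] at h
    rw [h]
    change ∑ j, (if G.Adj (f i) (f j) then 1 else 0) = 2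
    simp only [hadj]
    clear h
    revert i
    decide
  have key : ∀ r : ℝ, G.lapDet x + r * G.lapMinor x (f 0) = (1 + 2 * x) ^ 2 * (1 + 4 * x) +
      r * ((1 + 2 * x) * (1 + 4 * x + 2 * x ^ 2)) := fun r => by
    rw [← det_shiftedLap_add _ hx, ← det_cycle_four, ← det_submatrix_equiv_self e]
    congr 1
    ext i j
    have h1 : ∀ i, e i = f i := fun _ => rfl
    simp only [submatrix_apply, Matrix.add_apply, shiftedLap_apply, pairMatrix, of_apply, h1,
      hf.1.eq_iff, hadj, hdeg]
    fin_cases i <;> fin_cases j <;> simp [cycleGraph_four_adj_iff] <;> ring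
  have h0 := key 0
  have h1 := key 1
  simp only [starC4Det, starC4Minor]
  constructor
  · simp; linarith
  · simp; linarith

omit [DecidableEq V] in
theorem exists_adj_iff_of_degree_eq_two {v w : V} (h : G.degree v = 2) (hw : G.Adj v w) :
    ∃ b, b ≠ w ∧ ∀ y, G.Adj v y ↔ y = w ∨ y = b := by
  classical
  rw [← card_neighborFinset_eq_degree, Finset.card_eq_two] at h
  obtain ⟨p, q, hpq, h⟩ := h
  have h' : ∀ y, G.Adj v y ↔ y = p ∨ y = q := fun y => by
    rw [← mem_neighborFinset, h]; simp
  rcases (h' w).1 hw with rfl | rfl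
  · exact ⟨q, hpq.symm, h'⟩
  · exact ⟨p, hpq, fun y => by rw [h', or_comm]⟩

omit [Fintype V] [DecidableRel G.Adj] in
theorem deleteVert_connected_of_leaf (hG : G.Connected) {v : V} {w : {y // y ≠ v}}
    (hw : ∀ y, G.Adj v y ↔ y = w) : (G.deleteVert v).Connected := by
  refine hG.of_map (f := fun y => if h : y = v then w else ⟨y, h⟩)
    (fun y => ⟨y, by simp [y.2]⟩) fun y z hyz => ?_
  by_cases hy : y = v
  · subst hy
    have hz := (hw z).1 hyz
    subst hz
    left
    simp [w.2]
  · by_cases hz : z = v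
    · subst hz
      have hy' := (hw y).1 hyz.symm
      subst hy'
      left
      simp [w.2]
    · right
      simpa [hy, hz] using hyz

omit [Fintype V] [DecidableRel G.Adj] in
theorem suppress_connected (hG : G.Connected) {v : V} {a b : {y // y ≠ v}} (hab : a ≠ b)
    (hv : ∀ y, G.Adj v y ↔ y = a ∨ y = b) : (G.suppress v a b).Connected := by
  refine hG.of_map (f := fun y => if h : y = v then a else ⟨y, h⟩)
    (fun y => ⟨y, by simp [y.2]⟩) fun y z hyz => ?_
  have key : ∀ z, G.Adj v z → a = (if h : z = v then a else ⟨z, h⟩) ∨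
      (G.suppress v a b).Adj a (if h : z = v then a else ⟨z, h⟩) := fun z hz => by
    rcases (hv z).1 hz with rfl | rfl
    · left; simp [a.2]
    · right; simp [b.2, edge_adj, hab]
  by_cases hy : y = v
  · subst hy
    simpa using key z hyz
  · by_cases hz : z = v
    · subst hz
      rcases key y hyz.symm with h | h
      · left; simpa using h.symm
      · right; simpa using h.symm
    · right
      simp only [hy, hz, dif_neg, not_false_iff]
      exact Or.inl hyz

/-- The lower bounds for `det (1 + x L)` and its principal minors. -/
def LapBounds (G : SimpleGraph V) [DecidableRel G.Adj] (x : ℝ) (n : ℕ) : Prop :=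
  4 ≤ n ∧ (∀ u, starC4Minor x (n - 4) ≤ G.lapMinor x u ∧
      (G.lapMinor x u = starC4Minor x (n - 4) → G.degree u + 2 = n)) ∧
    starC4Det x (n - 4) ≤ G.lapDet x ∧
      (G.lapDet x = starC4Det x (n - 4) → ∃ c, G.degree c + 2 = n)

theorem lapBounds_of_leaf (hx : 0 < x) (hG : G.Connected) {v : V} {w : {y // y ≠ v}}
    (hw : ∀ y, G.Adj v y ↔ y = w) {n : ℕ} (hcard : Fintype.card {y // y ≠ v} = n)
    (ih : (G.deleteVert v).LapBounds x n) : G.LapBounds x (n + 1) := by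
  obtain ⟨h4, hR, hP, hPe⟩ := ih
  -- Subtraction is truncated, which is why `LapBounds` carries 4 ≤ n.
  have hsub : n + 1 - 4 = n - 4 + 1 := by omega
  have hdegw : G.degree w = (G.deleteVert v).degree w + 1 := by
    rw [degree_eq_deleteVert_degree_add, if_pos (((hw w).2 rfl).symm)]
  have hdet := lapDet_leaf hw hx
  refine ⟨by omega, fun u => ?_, ?_, fun heq => ?_⟩
  · rw [hsub, starC4Minor_succ]
    by_cases huv : u = v
    -- At the new leaf the minor is P' + xM'(w), and P' > M'(w) makes the bound strict; equality can
    -- survive only at w, whose degree grows by one.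
    · subst huv
      rw [lapMinor_leaf_self hw hx]
      have hcon := deleteVert_connected_of_leaf hG hw
      have : Nontrivial {y // y ≠ u} := Fintype.one_lt_card_iff_nontrivial.1 (by omega)
      have hlt := (G.deleteVert u).lapMinor_lt_lapDet hx
        (hcon.preconnected.degree_pos_of_nontrivial w)
      have hle := (hR w).1
      have := mul_le_mul_of_nonneg_left hle hx.le
      exact ⟨by linarith, fun h => by linarith⟩
    · have hle := (hR ⟨u, huv⟩).1
      have h1 := mul_le_mul_of_nonneg_left hle (by positivity : 0 ≤ 1 + x)
      by_cases huw : (⟨u, huv⟩ : {y // y ≠ v}) = w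
      · subst huw
        have h2 := lapMinor_leaf_neighbor hw hx
        dsimp only at h2
        rw [h2]
        refine ⟨h1, fun h => ?_⟩
        have := (hR _).2 (mul_left_cancel₀ (by positivity) h)
        dsimp only at hdegw
        omega
      · have h2 := lapMinor_leaf_lt hw hx huw
        dsimp only at h2
        exact ⟨by linarith, fun h => by linarith⟩
  · rw [hsub, starC4Det_succ hx, hdet]
    have h1 := mul_le_mul_of_nonneg_left (hR w).1 hx.le
    have h2 := mul_le_mul_of_nonneg_left hP (by positivity : 0 ≤ 1 + x)
    linarith
  · rw [hsub, starC4Det_succ hx, hdet] at heq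
    have h1 := mul_le_mul_of_nonneg_left (hR w).1 hx.le
    have h2 := mul_le_mul_of_nonneg_left hP (by positivity : 0 ≤ 1 + x)
    have h3 : x * (G.deleteVert v).lapMinor x w = x * starC4Minor x (n - 4) := by linarith
    have := (hR _).2 (mul_left_cancel₀ hx.ne' h3)
    exact ⟨w, by omega⟩

theorem lapBounds_of_suppress (hx : 0 < x) (hreg : ∀ v, G.degree v = 2)
    (htri : ∀ a b c, G.Adj a b → G.Adj b c → ¬ G.Adj a c) [Nonempty V] {n : ℕ}
    (hcard : Fintype.card V = n + 1) (hG : G.Connected)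
    (ih : ∀ (v : V) (a b : {y // y ≠ v}), (∀ y, (G.suppress v a b).degree y = 2) →
      (G.suppress v a b).Connected →
      (∀ i j k, (G.suppress v a b).Adj i j → (G.suppress v a b).Adj j k →
        ¬ (G.suppress v a b).Adj i k) → (G.suppress v a b).LapBounds x n) :
    G.LapBounds x (n + 1) := by
  have key : ∀ u : V, 4 ≤ n + 1 ∧ (starC4Minor x (n + 1 - 4) ≤ G.lapMinor x u ∧
      (G.lapMinor x u = starC4Minor x (n + 1 - 4) → G.degree u + 2 = n + 1)) ∧
      starC4Det x (n + 1 - 4) ≤ G.lapDet x ∧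
      (G.lapDet x = starC4Det x (n + 1 - 4) → ∃ c, G.degree c + 2 = n + 1) := by
    intro a
    obtain ⟨v, hav⟩ := (G.degree_pos_iff_exists_adj a).1 (by rw [hreg]; norm_num)
    obtain ⟨b, hba, hv⟩ := exists_adj_iff_of_degree_eq_two (hreg v) hav.symm
    obtain ⟨c, hcv, ha⟩ := exists_adj_iff_of_degree_eq_two (hreg a) hav
    have hvb : G.Adj v b := (hv b).2 (Or.inr rfl)
    have hac : G.Adj a c := (ha c).2 (Or.inr rfl)
    have hnab : ¬ G.Adj a b := htri a v b hav hvb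
    have hcb : c ≠ b := by rintro rfl; exact hnab hac
    -- The cycle contains the path c, a, v, b. If b and c are adjacent it closes up as a 4-cycle;
    -- otherwise v can be suppressed without creating a triangle.
    by_cases hbc : G.Adj b c
    · obtain ⟨b', hb', hb⟩ := exists_adj_iff_of_degree_eq_two (hreg b) hvb.symm
      have hcb' : c = b' := ((hb c).1 hbc).resolve_left hcv
      subst hcb'
      obtain ⟨c', hc', hc⟩ := exists_adj_iff_of_degree_eq_two (hreg c) hac.symm
      have hbc' : b = c' := ((hc b).1 hbc.symm).resolve_left hba
      subst hbc'
      have hinj : Function.Injective ![a, v, b, c] := by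
        have h1 := hav.ne
        have h2 := hvb.ne
        have h3 := hac.ne
        intro i j
        fin_cases i <;> fin_cases j <;> simp <;> tauto
      have hsurj : Function.Surjective ![a, v, b, c] := by
        -- These four vertices are closed under adjacency, so by connectedness they are all of V.
        have hclosed : ∀ y z, G.Adj y z → y ∈ Set.range ![a, v, b, c] →
            z ∈ Set.range ![a, v, b, c] := by
          rintro y z hyz ⟨i, rfl⟩
          fin_cases i
          · rcases (ha z).1 hyz with rfl | rfl
            exacts [⟨1, rfl⟩, ⟨3, rfl⟩]
          · rcases (hv z).1 hyz with rfl | rfl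
            exacts [⟨0, rfl⟩, ⟨2, rfl⟩]
          · rcases (hb z).1 hyz with rfl | rfl
            exacts [⟨1, rfl⟩, ⟨3, rfl⟩]
          · rcases (hc z).1 hyz with rfl | rfl
            exacts [⟨0, rfl⟩, ⟨2, rfl⟩]
        intro y
        obtain ⟨p⟩ := hG.preconnected a y
        have : ∀ s t, G.Walk s t → s ∈ Set.range ![a, v, b, c] →
            t ∈ Set.range ![a, v, b, c] := fun s t p => by
          induction p with
          | nil => exact id
          | cons h _ ih => exact fun hs => ih (hclosed _ _ h hs)
        exact this a y p ⟨0, rfl⟩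
      have hn : n = 3 := by
        have := Fintype.card_of_bijective (f := ![a, v, b, c]) ⟨hinj, hsurj⟩
        simp at this
        omega
      subst hn
      have hnvc : ¬ G.Adj v c := fun h => htri a v c hav h hac
      have hD := lapDet_and_lapMinor_of_cycle_four (G := G) hx ⟨hinj, hsurj⟩ (by
        have hnba : ¬ G.Adj b a := fun h => hnab h.symm
        have hncv : ¬ G.Adj c v := fun h => hnvc h.symm
        intro i j
        rw [cycleGraph_four_adj_iff]
        fin_cases i <;> fin_cases j <;> simp [hav, hav.symm, hvb, hvb.symm, hbc, hbc.symm, hac,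
          hac.symm, hnab, hnvc, hnba, hncv])
      have hM : G.lapMinor x a = starC4Minor x 0 := hD.2
      exact ⟨le_rfl, ⟨hM.ge, fun _ => by rw [hreg]⟩, hD.1.ge, fun _ => ⟨a, by rw [hreg]⟩⟩
    · let A : {y // y ≠ v} := ⟨a, hav.ne⟩
      let B : {y // y ≠ v} := ⟨b, hvb.ne'⟩
      have hAB : A ≠ B := fun h => hba (congrArg Subtype.val h).symm
      have hdeg : ∀ y : {y // y ≠ v}, (G.suppress v A B).degree y = 2 := fun y => by
        rw [suppress_degree (a := A) (b := B) hAB hnab y, ← hreg y,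
          degree_eq_deleteVert_degree_add]
        congr 1
        refine if_congr ?_ rfl rfl
        rw [adj_comm, hv, Subtype.ext_iff, Subtype.ext_iff]
      have hcommon : ∀ y : {y // y ≠ v}, G.Adj a y → ¬ G.Adj b y := fun y hy hy' => by
        rcases (ha y).1 hy with h | h
        · exact y.2 h
        · rw [h] at hy'; exact hbc hy'
      have hS : ∀ i j, (G.suppress v A B).Adj i j ↔ G.Adj i j ∨ (i = A ∧ j = B) ∨
          (i = B ∧ j = A) := fun i j => by
        rw [suppress, sup_adj, edge_adj]
        constructor
        · rintro (h | h)
          exacts [Or.inl h, Or.inr h.1]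
        · rintro (h | ⟨rfl, rfl⟩ | ⟨rfl, rfl⟩)
          exacts [Or.inl h, Or.inr ⟨Or.inl ⟨rfl, rfl⟩, hAB⟩, Or.inr ⟨Or.inr ⟨rfl, rfl⟩, hAB.symm⟩]
      have hnba : ¬ G.Adj b a := fun h => hnab h.symm
      have htri' : ∀ i j k, (G.suppress v A B).Adj i j → (G.suppress v A B).Adj j k →
          ¬ (G.suppress v A B).Adj i k := by
        intro i j k hij hjk hik
        have n1 := hij.ne
        have n2 := hjk.ne
        have n3 := hik.ne
        rw [hS] at hij hjk hik
        rcases hij with hij | ⟨rfl, rfl⟩ | ⟨rfl, rfl⟩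
        · rcases hjk with hjk | ⟨rfl, rfl⟩ | ⟨rfl, rfl⟩
          · rcases hik with hik | ⟨rfl, rfl⟩ | ⟨rfl, rfl⟩
            · exact htri _ _ _ hij hjk hik
            · exact hcommon _ hij hjk.symm
            · exact hcommon _ hjk.symm hij
          · rcases hik with hik | ⟨h, -⟩ | ⟨h, -⟩
            · exact hcommon _ hij.symm hik.symm
            · exact n1 h
            · exact n3 h
          · rcases hik with hik | ⟨h, -⟩ | ⟨h, -⟩
            · exact hcommon _ hik.symm hij.symm
            · exact n3 h
            · exact n1 h
        · rcases hjk with hjk | ⟨h, -⟩ | ⟨h, h'⟩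
          · rcases hik with hik | ⟨-, h⟩ | ⟨h, -⟩
            · exact hcommon _ hik hjk
            · exact n2 h.symm
            · exact n1 h
          · exact n1 h.symm
          · exact n3 h'.symm
        · rcases hjk with hjk | ⟨h, h'⟩ | ⟨h, -⟩
          · rcases hik with hik | ⟨h, -⟩ | ⟨-, h⟩
            · exact hcommon _ hjk hik
            · exact n1 h
            · exact n2 h.symm
          · exact n3 h'.symm
          · exact n1 h.symm
      have hv' : ∀ y, G.Adj v y ↔ y = A ∨ y = B := hv
      obtain ⟨h4, hR, hP, -⟩ := ih v A B hdeg (suppress_connected hG hAB hv') htri'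
      have hdegA : 0 < (G.deleteVert v).degree A := by
        rw [degree_pos_iff_exists_adj]
        exact ⟨⟨c, hcv⟩, hac⟩
      obtain ⟨b1, b2⟩ := suppress_bounds hAB hv' hnab hx hdegA
      have hsub : n + 1 - 4 = n - 4 + 1 := by omega
      have h1 := mul_le_mul_of_nonneg_left (hR A).1 hx.le
      have h2 := mul_le_mul_of_nonneg_left (hR A).1 (by positivity : 0 ≤ 1 + x)
      have h3 := mul_le_mul_of_nonneg_left hP (by positivity : 0 ≤ 1 + x)
      rw [hsub, starC4Det_succ hx, starC4Minor_succ]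
      change _ < G.lapMinor x a at b1
      -- Both bounds are strict here, so the equality clauses hold vacuously.
      exact ⟨by omega, ⟨by linarith, fun h => by linarith⟩, by linarith, fun h => by linarith⟩
  exact ⟨(key (Classical.arbitrary V)).1, fun u => (key u).2.1, (key (Classical.arbitrary V)).2.2⟩

end

theorem lapBounds_of_triangle_free {x : ℝ} (hx : 0 < x) (n : ℕ) : ∀ {V : Type u} [Fintype V]
    [DecidableEq V] (G : SimpleGraph V) [DecidableRel G.Adj], Fintype.card V = n → G.Connected →
    ∑ v, G.degree v = 2 * n → (∀ a b c, G.Adj a b → G.Adj b c → ¬ G.Adj a c) →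
    G.LapBounds x n := by
  induction n with
  | zero =>
    intro V _ _ G _ hcard hG
    have := hG.nonempty
    exact absurd hcard Fintype.card_ne_zero
  | succ n ih =>
    intro V _ _ G _ hcard hG hsum htri
    have hne := hG.nonempty
    have hcard' : ∀ v : V, Fintype.card {y // y ≠ v} = n := fun v => by
      rw [Fintype.card_subtype_compl, Fintype.card_subtype_eq, hcard]; rfl
    by_cases hleaf : ∃ v, G.degree v = 1
    · obtain ⟨v, hdeg⟩ := hleaf
      obtain ⟨w₀, hw₀⟩ := Finset.card_eq_one.1 (G.card_neighborFinset_eq_degree v ▸ hdeg)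
      have hw' : ∀ y, G.Adj v y ↔ y = w₀ := fun y => by rw [← mem_neighborFinset, hw₀]; simp
      let w : {y // y ≠ v} := ⟨w₀, ((hw' w₀).2 rfl).ne'⟩
      have hw : ∀ y, G.Adj v y ↔ y = w := hw'
      refine lapBounds_of_leaf hx hG hw (hcard' v) (ih _ (hcard' v)
        (deleteVert_connected_of_leaf hG hw) ?_ fun a b c => htri a b c)
      rw [Fintype.sum_eq_add_sum_subtype_ne _ v, hdeg] at hsum
      simp only [degree_eq_deleteVert_degree_add, Finset.sum_add_distrib] at hsum
      have : ∑ y : {y // y ≠ v}, (if G.Adj y v then 1 else 0) = 1 := by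
        rw [Finset.sum_eq_single w]
        · rw [if_pos ((hw w).2 rfl).symm]
        · intro y _ hy
          rw [if_neg]
          rw [adj_comm, hw, ← Subtype.ext_iff]
          exact hy
        · simp
      omega
    · have hn : n ≠ 0 := by
        rintro rfl
        have : Subsingleton V := Fintype.card_le_one_iff_subsingleton.1 hcard.le
        have h0 : ∀ v, G.degree v = 0 := fun v => by
          by_contra h
          obtain ⟨w, hw⟩ := (G.degree_pos_iff_exists_adj v).1 (Nat.pos_of_ne_zero h)
          exact hw.ne (Subsingleton.elim _ _)
        rw [Finset.sum_eq_zero fun v _ => h0 v] at hsum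
        omega
      have : Nontrivial V := Fintype.one_lt_card_iff_nontrivial.1 (by omega)
      have h2 : ∀ v ∈ Finset.univ, 2 ≤ G.degree v := fun v _ => by
        have := hG.preconnected.degree_pos_of_nontrivial v
        have : G.degree v ≠ 1 := fun h => hleaf ⟨v, h⟩
        omega
      -- All degrees are at least 2 and their average is 2.
      have hreg : ∀ v, G.degree v = 2 := fun v => by
        refine ((Finset.sum_eq_sum_iff_of_le h2).1 ?_ v (Finset.mem_univ v)).symm
        rw [hsum]
        simp [hcard, mul_comm]
      refine lapBounds_of_suppress hx hreg htri hcard hG fun v a b hd hc ht =>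
        ih _ (hcard' v) hc ?_ ht
      simp only [hd]
      rw [Finset.sum_const, Finset.card_univ, hcard', smul_eq_mul, mul_comm]

end SimpleGraph

/-! ### Spectrum of Q, bipartiteness and energy comparison -/

open Matrix in
theorem Matrix.IsHermitian.det_one_add_smul {n : Type*} [Fintype n] [DecidableEq n]
    {A : Matrix n n ℝ} (hA : A.IsHermitian) (x : ℝ) :
    (1 + x • A).det = ∏ i, (1 + x * hA.eigenvalues i) := by
  by_cases hx : x = 0
  · simp [hx]
  have h := congrArg (Polynomial.eval (-x⁻¹)) hA.charpoly_eq
  rw [eval_charpoly, Polynomial.eval_prod] at h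
  have h1 : 1 + x • A = (-x) • (scalar n (-x⁻¹) - A) := by
    ext i j
    by_cases hij : i = j
    · subst hij; simp; field_simp; ring
    · simp [hij]
  rw [h1, det_smul, h, ← Finset.card_univ, ← Finset.prod_const, ← Finset.prod_mul_distrib]
  refine Finset.prod_congr rfl fun i _ => ?_
  simp
  field_simp
  ring

namespace SimpleGraph

open Matrix

section

variable {V : Type*} [Fintype V]

/-- Removing an edge ab of a shortest cycle leaves a tree, which is 2-colourable. The rest of the
cycle joins a to b by an odd walk, so they have different colours and the edge can be restored. -/
theorem IsUnicyclic.coloring_of_even_girth {G : SimpleGraph V} (hG : G.IsUnicyclic)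
    (heven : Even G.girth) : Nonempty (G.Coloring Bool) := by
  classical
  -- Acyclic graphs have girth 0 by convention, which is even; forests are bipartite anyway.
  by_cases hac : G.IsAcyclic
  · exact ⟨hac.isBipartite.toColoring (by simp)⟩
  obtain ⟨a, w, hw, hlen⟩ := exists_girth_eq_length.2 hac
  rw [hlen] at heven
  cases w with
  | nil => exact absurd hw Walk.not_isCycle_nil
  | @cons _ b _ hab p =>
    obtain ⟨hp, he⟩ := (Walk.cons_isCycle_iff p hab).1 hw
    have hcon : (G.deleteEdges {s(a, b)}).Connected :=
      hG.1.connected_delete_edge_of_not_isBridge fun h =>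
        h.notMem_edges_of_isCycle hw (by simp)
    have hcard : Nat.card (G.deleteEdges {s(a, b)}).edgeSet + 1 = Nat.card V := by
      rw [Nat.card_coe_set_eq, edgeSet_deleteEdges,
        Set.ncard_sdiff_singleton_add_one (G.mem_edgeSet.2 hab), hG.2, Nat.card_eq_fintype_card]
    have htree := isTree_iff_connected_and_card.2 ⟨hcon, hcard⟩
    have c : (G.deleteEdges {s(a, b)}).Coloring Bool := htree.isBipartite.toColoring (by simp)
    let q := p.toDeleteEdge s(a, b) he
    have hq : q.length = p.length := Walk.length_transfer ..
    have hodd : ¬ Even q.length := by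
      rw [Walk.length_cons, Nat.even_add_one] at heven
      rwa [hq]
    rw [c.even_length_iff_congr] at hodd
    refine ⟨Coloring.mk c fun {x y} hxy => ?_⟩
    by_cases hs : s(x, y) = s(a, b)
    · rcases Sym2.eq_iff.1 hs with ⟨rfl, rfl⟩ | ⟨rfl, rfl⟩
      · exact fun h => hodd (by rw [h])
      · exact fun h => hodd (by rw [h])
    · exact c.valid (deleteEdges_adj.2 ⟨hxy, by simpa using hs⟩)

omit [Fintype V] in
theorem Coloring.even_girth {G : SimpleGraph V} (c : G.Coloring Bool) : Even G.girth := by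
  by_cases hac : G.IsAcyclic
  · rw [girth_eq_zero.2 hac]; exact Even.zero
  · obtain ⟨a, w, -, hlen⟩ := exists_girth_eq_length.2 hac
    rw [hlen, c.even_length_iff_congr]

variable [DecidableEq V]

/-- Adjacent vertices carry opposite signs, so the conjugation flips exactly the off-diagonal
entries. -/
theorem Coloring.signlessLapMatrix_eq {G : SimpleGraph V} [DecidableRel G.Adj]
    (c : G.Coloring Bool) :
    G.signlessLapMatrix = diagonal (fun i => if c i then (1 : ℝ) else -1) * G.lapMatrix ℝ *
      diagonal (fun i => if c i then 1 else -1) := by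
  ext i j
  rw [mul_diagonal, diagonal_mul]
  by_cases hij : i = j
  · subst hij
    cases c i <;> simp [signlessLapMatrix, lapMatrix]
  · by_cases h : G.Adj i j
    · have := c.valid h
      revert this
      cases c i <;> cases c j <;> simp [signlessLapMatrix, lapMatrix, degMatrix, hij, h]
    · simp [signlessLapMatrix, lapMatrix, degMatrix, hij, h]

theorem Coloring.posSemidef_signlessLapMatrix {G : SimpleGraph V} [DecidableRel G.Adj]
    (c : G.Coloring Bool) : G.signlessLapMatrix.PosSemidef := by
  rw [c.signlessLapMatrix_eq]
  have h := (posSemidef_lapMatrix ℝ G).mul_mul_conjTranspose_same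
    (diagonal (fun i => if c i then (1 : ℝ) else -1))
  rwa [diagonal_conjTranspose, star_trivial] at h

theorem Coloring.det_one_add_signlessLapMatrix {G : SimpleGraph V} [DecidableRel G.Adj]
    (c : G.Coloring Bool) (x : ℝ) : (1 + x • G.signlessLapMatrix).det = G.lapDet x := by
  set S : Matrix V V ℝ := diagonal (fun i => if c i then (1 : ℝ) else -1) with hS
  have hSS : S * S = 1 := by
    rw [hS, diagonal_mul_diagonal, ← diagonal_one]
    congr 1
    ext i
    cases c i <;> simp
  have h : 1 + x • G.signlessLapMatrix = S * G.shiftedLap x * S := by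
    rw [c.signlessLapMatrix_eq, shiftedLap, Matrix.mul_add, Matrix.add_mul, Matrix.mul_one, hSS]
    simp [hS]
  rw [h, det_mul, det_mul, mul_right_comm, ← det_mul, hSS, det_one, one_mul, lapDet]

omit [DecidableEq V] in
theorem Iso.lapDet_eq {W : Type*} [Fintype W] {_ : DecidableEq V} {_ : DecidableEq W}
    {G : SimpleGraph V} {_ : DecidableRel G.Adj} {H : SimpleGraph W} {_ : DecidableRel H.Adj} (f : G ≃g H) (x : ℝ) :
    G.lapDet x = H.lapDet x := by
  rw [lapDet, lapDet, ← det_submatrix_equiv_self f.toEquiv]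
  congr 1
  ext i j
  have h := f.map_adj_iff (v := i) (w := j)
  have h1 : f i = f j ↔ i = j := f.injective.eq_iff
  change G.shiftedLap x i j = H.shiftedLap x (f i) (f j)
  simp only [shiftedLap_apply, h, h1, f.degree_eq]

end

section Energy

variable {V W : Type*} [Fintype V] [Fintype W] {G : SimpleGraph V} {H : SimpleGraph W}

open Classical in
theorem incidenceEnergy_le (c : G.Coloring Bool) (d : H.Coloring Bool)
    (h : ∀ x, 0 < x → G.lapDet x ≤ H.lapDet x) : G.incidenceEnergy ≤ H.incidenceEnergy := by
  refine sum_sqrt_le_of_prod_le c.posSemidef_signlessLapMatrix.eigenvalues_nonneg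
    d.posSemidef_signlessLapMatrix.eigenvalues_nonneg fun x hx => ?_
  rw [← IsHermitian.det_one_add_smul, ← IsHermitian.det_one_add_smul,
    c.det_one_add_signlessLapMatrix, d.det_one_add_signlessLapMatrix]
  exact h x hx

open Classical in
theorem incidenceEnergy_lt (c : G.Coloring Bool) (d : H.Coloring Bool)
    (h : ∀ x, 0 < x → G.lapDet x < H.lapDet x) : G.incidenceEnergy < H.incidenceEnergy := by
  refine sum_sqrt_lt_of_prod_lt c.posSemidef_signlessLapMatrix.eigenvalues_nonneg
    d.posSemidef_signlessLapMatrix.eigenvalues_nonneg fun x hx => ?_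
  rw [← IsHermitian.det_one_add_smul, ← IsHermitian.det_one_add_smul,
    c.det_one_add_signlessLapMatrix, d.det_one_add_signlessLapMatrix]
  exact h x hx

end Energy

/-! ### The extremal graph: its determinant and its characterisation -/

section StarC4

variable (n : ℕ)

/-- The proper 2-colouring of `S₄'`. -/
def starC4Coloring : (starC4 n).Coloring Bool :=
  Coloring.mk (Sum.elim (fun i => decide (i.val % 2 = 1)) fun _ => false) (by
    rintro (i | i) (j | j) h
    · have := (cycleGraph_four_adj_iff i j).1 h
      simp only [Sum.elim_inl, ne_eq, decide_eq_decide]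
      omega
    · have h : i = 3 := h
      subst h
      simp
    · have h : j = 3 := h
      subst h
      simp
    · exact h.elim)

theorem starC4_connected : (starC4 n).Connected := by
  have key : ∀ x, (starC4 n).Reachable x (Sum.inl 3) := by
    have h03 : (starC4 n).Adj (Sum.inl 0) (Sum.inl 3) := (cycleGraph_four_adj_iff 0 3).2 rfl
    have h23 : (starC4 n).Adj (Sum.inl 2) (Sum.inl 3) := (cycleGraph_four_adj_iff 2 3).2 rfl
    have h10 : (starC4 n).Adj (Sum.inl 1) (Sum.inl 0) := (cycleGraph_four_adj_iff 1 0).2 rfl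
    rintro (i | j)
    · fin_cases i
      · exact h03.reachable
      · exact h10.reachable.trans h03.reachable
      · exact h23.reachable
      · exact Reachable.refl _
    · have : (starC4 n).Adj (Sum.inr j) (Sum.inl 3) := rfl
      exact this.reachable
  have : Nonempty (Fin 4 ⊕ Fin (n - 4)) := ⟨Sum.inl 0⟩
  exact ⟨fun x y => (key x).trans (key y).symm⟩

variable [DecidableRel (starC4 n).Adj]

theorem starC4_degree_inl (i : Fin 4) :
    (starC4 n).degree (Sum.inl i) = 2 + if i = 3 then n - 4 else 0 := by
  have h := degree_eq_sum_if_adj (starC4 n) (R := ℕ) (Sum.inl i)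
  have h1 : ∀ j, (starC4 n).Adj (Sum.inl i) (Sum.inl j) ↔ (i.val + j.val) % 2 = 1 :=
    fun j => cycleGraph_four_adj_iff i j
  have h2 : ∀ j, (starC4 n).Adj (Sum.inl i) (Sum.inr j) ↔ i = 3 := fun j => Iff.rfl
  simp only [Nat.cast_id, Fintype.sum_sum_type, h1, h2, Finset.sum_const, Finset.card_univ,
    Fintype.card_fin, smul_eq_mul] at h
  rw [h]
  congr 1
  · clear h h1 h2
    revert i
    decide
  · split_ifs <;> simp

theorem starC4_degree_inr (j : Fin (n - 4)) : (starC4 n).degree (Sum.inr j) = 1 := by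
  have h := degree_eq_sum_if_adj (starC4 n) (R := ℕ) (Sum.inr j)
  have h1 : ∀ i, (starC4 n).Adj (Sum.inr j) (Sum.inl i) ↔ i = 3 := fun i => Iff.rfl
  have h2 : ∀ i, (starC4 n).Adj (Sum.inr j) (Sum.inr i) ↔ False := fun i => Iff.rfl
  simp only [Nat.cast_id, Fintype.sum_sum_type, h1, h2] at h
  simpa using h

omit [DecidableRel (starC4 n).Adj] in
theorem starC4_isUnicyclic : (starC4 n).IsUnicyclic := by
  classical
  refine ⟨starC4_connected n, ?_⟩
  have h := (starC4 n).sum_degrees_eq_twice_card_edges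
  simp only [Fintype.sum_sum_type, starC4_degree_inl, starC4_degree_inr] at h
  rw [← coe_edgeFinset, Set.ncard_coe_finset]
  simp [Finset.sum_add_distrib] at h ⊢
  omega

omit [DecidableRel (starC4 n).Adj] in
theorem starC4_lapDet {inst : DecidableEq (Fin 4 ⊕ Fin (n - 4))}
    {_ : DecidableRel (starC4 n).Adj} {x : ℝ} (hx : 0 < x) :
    (starC4 n).lapDet x = starC4Det x (n - 4) := by
  obtain rfl : inst = instDecidableEqSum := Subsingleton.elim _ _
  have hx' : 1 + x ≠ 0 := by positivity
  let A : Matrix (Fin 4) (Fin 4) ℝ := !![1 + 2 * x, -x, 0, -x; -x, 1 + 2 * x, -x, 0;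
    0, -x, 1 + 2 * x, -x; -x, 0, -x, 1 + 2 * x + (n - 4 : ℕ) * x]
  let B : Matrix (Fin 4) (Fin (n - 4)) ℝ := of fun i _ => if i = 3 then -x else 0
  let C : Matrix (Fin (n - 4)) (Fin 4) ℝ := of fun _ i => if i = 3 then -x else 0
  let D : Matrix (Fin (n - 4)) (Fin (n - 4)) ℝ := diagonal fun _ => 1 + x
  have hblock : (starC4 n).shiftedLap x = fromBlocks A B C D := by
    ext (i | i) (j | j)
    · have h1 : (starC4 n).Adj (Sum.inl i) (Sum.inl j) ↔ (i.val + j.val) % 2 = 1 :=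
        cycleGraph_four_adj_iff i j
      simp only [shiftedLap_apply, starC4_degree_inl, h1, Sum.inl.injEq, fromBlocks_apply₁₁]
      fin_cases i <;> fin_cases j <;> simp [A] <;> ring
    · have h1 : (starC4 n).Adj (Sum.inl i) (Sum.inr j) ↔ i = 3 := Iff.rfl
      simp [shiftedLap_apply, h1, B]
    · have h1 : (starC4 n).Adj (Sum.inr i) (Sum.inl j) ↔ j = 3 := Iff.rfl
      simp [shiftedLap_apply, h1, C]
    · have h1 : (starC4 n).Adj (Sum.inr i) (Sum.inr j) ↔ False := Iff.rfl
      simp [shiftedLap_apply, h1, D, starC4_degree_inr, diagonal_apply]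
  let _ : Invertible D :=
    { invOf := diagonal fun _ => (1 + x)⁻¹
      invOf_mul_self := by simp [D, hx']
      mul_invOf_self := by simp [D, hx'] }
  have hD : ⅟D = diagonal fun _ => (1 + x)⁻¹ := rfl
  -- Eliminating the pendent block leaves a 4-cycle with extra weight at the centre; the rotation by
  -- 3 moves the centre from index 3 to index 0, as in `det_cycle_four`.
  have hS : (A - B * ⅟D * C).submatrix (Equiv.addRight 3) (Equiv.addRight 3) =
      !![1 + 2 * x + (n - 4 : ℕ) * (x / (1 + x)), -x, 0, -x; -x, 1 + 2 * x, -x, 0;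
        0, -x, 1 + 2 * x, -x; -x, 0, -x, 1 + 2 * x] := by
    have hE : ∀ i j, (B * ⅟D * C) i j =
        if i = 3 ∧ j = 3 then (n - 4 : ℕ) * (x ^ 2 / (1 + x)) else 0 := fun i j => by
      rw [hD, mul_apply]
      simp only [mul_diagonal, B, C, of_apply]
      by_cases hi : i = 3 <;> by_cases hj : j = 3 <;> simp [hi, hj]
      left
      field_simp
    ext i j
    simp only [submatrix_apply, Matrix.sub_apply, hE]
    fin_cases i <;> fin_cases j <;> simp [A]
    field_simp
    ring
  rw [lapDet, hblock, det_fromBlocks₂₂, ← det_submatrix_equiv_self (Equiv.addRight (3 : Fin 4)),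
    hS, det_cycle_four]
  simp only [D, det_diagonal, Finset.prod_const, Finset.card_univ, Fintype.card_fin, starC4Det,
    starC4Minor]
  ring

end StarC4

/-- The vertex c has a single non-neighbour o, and its neighbours are pairwise nonadjacent. Hence
each neighbour has degree 1, or 2 if it is also joined to o, and the degree sum 2(n-2) + 2 deg o =
2n gives deg o = 2. So o closes a 4-cycle with c and two of its neighbours, and the other neighbours
are pendent. -/
theorem nonempty_iso_starC4 {V : Type*} [Fintype V] [DecidableEq V] {G : SimpleGraph V}
    [DecidableRel G.Adj] {n : ℕ} (hn : 4 ≤ n) (hcard : Fintype.card V = n)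
    (hsum : ∑ v, G.degree v = 2 * n) (htri : ∀ a b c, G.Adj a b → G.Adj b c → ¬ G.Adj a c)
    {c : V} (hc : G.degree c + 2 = n) : Nonempty (G ≃g starC4 n) := by
  set N := G.neighborFinset c with hN
  have hNcard : N.card + 2 = n := by rw [hN, card_neighborFinset_eq_degree, hc]
  have hcN : c ∉ N := by simp [hN]
  obtain ⟨o, ho⟩ : ∃ o, (insert c N)ᶜ = {o} := by
    rw [← Finset.card_eq_one, Finset.card_compl, Finset.card_insert_of_notMem hcN, hcard]
    omega
  have hmem : ∀ y, (¬ y = c ∧ ¬ G.Adj c y) ↔ y = o := fun y => by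
    have : y ∈ (insert c N)ᶜ ↔ y = o := by rw [ho, Finset.mem_singleton]
    simpa [hN] using this
  obtain ⟨hoc, hnco⟩ := (hmem o).2 rfl
  have hoN : o ∉ N := by simpa [hN] using hnco
  have hnoc : ¬ G.Adj o c := fun h => hnco h.symm
  have hdegN : ∀ y ∈ N, G.degree y = 1 + if G.Adj o y then 1 else 0 := fun y hy => by
    have hcy : G.Adj c y := by simpa [hN] using hy
    have hz : ∀ z, G.Adj y z → z = c ∨ z = o := fun z hz => by
      by_contra h
      rw [not_or] at h
      exact h.2 ((hmem z).1 ⟨h.1, htri c y z hcy hz⟩)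
    rw [← card_neighborFinset_eq_degree]
    by_cases hyo : G.Adj o y
    · rw [if_pos hyo, Finset.card_eq_two.2 ⟨c, o, Ne.symm hoc, ?_⟩]
      ext z
      simp only [mem_neighborFinset, Finset.mem_insert, Finset.mem_singleton]
      refine ⟨hz z, ?_⟩
      rintro (rfl | rfl)
      exacts [hcy.symm, hyo.symm]
    · rw [if_neg hyo, Finset.card_eq_one.2 ⟨c, ?_⟩]
      ext z
      simp only [mem_neighborFinset, Finset.mem_singleton]
      constructor
      · intro h
        rcases hz z h with rfl | rfl
        · rfl
        · exact absurd h.symm hyo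
      · rintro rfl
        exact hcy.symm
  have hdego : G.degree o = 2 := by
    have huniv : (Finset.univ : Finset V) = insert c (insert o N) := by
      ext y
      simp only [Finset.mem_univ, Finset.mem_insert, true_iff]
      have := (hmem y).1
      simp only [hN, mem_neighborFinset]
      tauto
    have hNo : N.filter (G.Adj o) = G.neighborFinset o := by
      ext y
      simp only [Finset.mem_filter, mem_neighborFinset, hN, and_iff_right_iff_imp]
      intro hy
      by_contra h
      by_cases hyc : y = c
      · subst hyc; exact hnoc hy
      · exact hy.ne' ((hmem y).1 ⟨hyc, h⟩)
    rw [huniv, Finset.sum_insert (by simp [hcN, Ne.symm hoc]), Finset.sum_insert hoN,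
      Finset.sum_congr rfl hdegN, Finset.sum_add_distrib, Finset.sum_const, ← Finset.card_filter,
      hNo, G.card_neighborFinset_eq_degree o, smul_eq_mul, mul_one] at hsum
    omega
  rw [← card_neighborFinset_eq_degree, Finset.card_eq_two] at hdego
  obtain ⟨p, q, hpq, ho'⟩ := hdego
  have hadjo : ∀ y, G.Adj o y ↔ y = p ∨ y = q := fun y => by
    rw [← mem_neighborFinset, ho']; simp
  have hop := (hadjo p).2 (Or.inl rfl)
  have hoq := (hadjo q).2 (Or.inr rfl)
  have hoc' : ∀ y, G.Adj o y → G.Adj c y := fun y hy => by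
    by_contra h
    by_cases hyc : y = c
    · subst hyc; exact hnoc hy
    · exact hy.ne' ((hmem y).1 ⟨hyc, h⟩)
  have hcp := hoc' p hop
  have hcq := hoc' q hoq
  have hindep : ∀ y z, G.Adj c y → G.Adj c z → ¬ G.Adj y z := fun y z hy hz h =>
    htri c y z hy h hz
  set R := N \ {p, q} with hR
  have hRcard : R.card = n - 4 := by
    rw [hR, Finset.card_sdiff_of_subset, Finset.card_pair hpq]
    · omega
    · intro y
      simp only [Finset.mem_insert, Finset.mem_singleton, hN, mem_neighborFinset]
      rintro (rfl | rfl)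
      exacts [hcp, hcq]
  let e := R.equivFinOfCardEq hRcard
  have he : ∀ j, G.Adj c (e.symm j) ∧ (e.symm j : V) ≠ p ∧ (e.symm j : V) ≠ q := fun j => by
    have h := Finset.mem_sdiff.1 (e.symm j).2
    simpa only [hN, mem_neighborFinset, Finset.mem_insert, Finset.mem_singleton, not_or] using h
  -- The order p, o, q, c follows the cycle and puts c at index 3, the centre of `starC4`.
  let f : Fin 4 ⊕ Fin (n - 4) → V := Sum.elim ![p, o, q, c] fun j => e.symm j
  have heo : ∀ j, (e.symm j : V) ≠ o := fun j h => hnco (h ▸ (he j).1)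
  have hinj : Function.Injective f := by
    refine Function.Injective.sumElim ?_ (Subtype.val_injective.comp e.symm.injective) ?_
    · have h1 := hop.ne
      have h2 := hoq.ne
      have h3 := hcp.ne
      have h4 := hcq.ne
      intro i j
      fin_cases i <;> fin_cases j <;> simp <;> tauto
    · intro i j
      have h1 := (he j).1.ne
      have h2 := (he j).2
      have h3 := heo j
      fin_cases i
      exacts [h2.1.symm, h3.symm, h2.2.symm, h1]
  have hbij : Function.Bijective f := by
    rw [Fintype.bijective_iff_injective_and_card]
    refine ⟨hinj, ?_⟩
    rw [hcard]
    simp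
    omega
  have hno : ∀ j, ¬ G.Adj o (e.symm j) := fun j h => by
    rcases (hadjo _).1 h with h | h
    exacts [(he j).2.1 h, (he j).2.2 h]
  have hlr : ∀ i j, G.Adj (f (Sum.inl i)) (f (Sum.inr j)) ↔ i = 3 := fun i j => by
    have h1 := hindep _ _ hcp (he j).1
    have h2 := hindep _ _ hcq (he j).1
    have h3 := (he j).1
    have h4 := hno j
    fin_cases i <;> simp [f, h1, h2, h3, h4]
  have hnpq := hindep _ _ hcp hcq
  have hnqp := hindep _ _ hcq hcp
  refine ⟨Iso.symm ⟨Equiv.ofBijective f hbij, ?_⟩⟩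
  rintro (i | i) (j | j)
  · change G.Adj _ _ ↔ (cycleGraph 4).Adj i j
    rw [cycleGraph_four_adj_iff]
    fin_cases i <;> fin_cases j <;>
      simp [f, hop, hop.symm, hoq, hoq.symm, hcp, hcp.symm, hcq, hcq.symm, hnco, hnoc, hnpq, hnqp]
  · exact hlr i j
  · exact (adj_comm ..).trans (hlr j i)
  · change G.Adj _ _ ↔ False
    rw [iff_false]
    exact hindep _ _ (he i).1 (he j).1

end SimpleGraph

theorem corollary5p4 (n : ℕ) (hn : 4 ≤ n) :
    (Fintype.card (Fin 4 ⊕ Fin (n - 4)) = n ∧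
      (SimpleGraph.starC4 n).IsUnicyclic ∧ Even (SimpleGraph.starC4 n).girth) ∧
    ∀ {V : Type*} [Fintype V] (G : SimpleGraph V),
      Fintype.card V = n → G.IsUnicyclic → Even G.girth →
        (SimpleGraph.starC4 n).incidenceEnergy ≤ G.incidenceEnergy ∧
        (G.incidenceEnergy = (SimpleGraph.starC4 n).incidenceEnergy ↔
          Nonempty (G ≃g SimpleGraph.starC4 n)) := by
  classical
  refine ⟨⟨by simp; omega, SimpleGraph.starC4_isUnicyclic n,
    (SimpleGraph.starC4Coloring n).even_girth⟩, ?_⟩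
  intro V _ G hcard hG heven
  obtain ⟨c⟩ := hG.coloring_of_even_girth heven
  have d := SimpleGraph.starC4Coloring n
  have htri : ∀ i j k, G.Adj i j → G.Adj j k → ¬ G.Adj i k := fun i j k hij hjk hik => by
    have h1 := c.valid hij
    have h2 := c.valid hjk
    have h3 := c.valid hik
    revert h1 h2 h3
    cases c i <;> cases c j <;> cases c k <;> simp
  have hsum : ∑ v, G.degree v = 2 * n := by
    rw [G.sum_degrees_eq_twice_card_edges, ← hcard, ← hG.2, ← SimpleGraph.coe_edgeFinset,
      Set.ncard_coe_finset]
  have hbound := fun (x : ℝ) (hx : 0 < x) =>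
    SimpleGraph.lapBounds_of_triangle_free hx n G hcard hG.1 hsum htri
  have hle : (SimpleGraph.starC4 n).incidenceEnergy ≤ G.incidenceEnergy := by
    refine SimpleGraph.incidenceEnergy_le d c fun x hx => ?_
    rw [SimpleGraph.starC4_lapDet n hx]
    exact (hbound x hx).2.2.1
  refine ⟨hle, fun heq => ?_, fun ⟨f⟩ => ?_⟩
  -- Without an isomorphism the determinant inequality is strict at every x > 0, hence so is the
  -- energy inequality.
  · by_contra hiso
    refine (SimpleGraph.incidenceEnergy_lt d c fun x hx => ?_).ne' heq
    rw [SimpleGraph.starC4_lapDet n hx]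
    refine lt_of_le_of_ne (hbound x hx).2.2.1 fun h => hiso ?_
    obtain ⟨v, hv⟩ := (hbound x hx).2.2.2 h.symm
    exact SimpleGraph.nonempty_iso_starC4 hn hcard hsum htri hv
  · exact le_antisymm (SimpleGraph.incidenceEnergy_le c d fun x _ => (f.lapDet_eq x).le) hle
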